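/- **Proposition 4.4.** Let $R$ be a commutative artinian ring and $A$ an Artin $R$-algebra (an $R$-algebra that is finitely generated as an $R$-module), and let $A\text{-mod}$ be the category of finitely generated left $A$-modules. Let $F$ be an additive subbifunctor of $\mathrm{Ext}^1_A(-,-)$ on $A\text{-mod}$: subgroups $F(Z,X)\subseteq \mathrm{Ext}^1_A(Z,X)$ stable under pullback in $Z$ and pushout in $X$; write $\mathrm{Ext}^1_F(M,-)$ for the functor $F(M,-)$ from $A\text{-mod}$ to abelian groups. A short exact sequence $0\to X\to Y\xrightarrow{g} Z\to 0$ in $A\text{-mod}$ is *$F$-exact* if its class lies in $F(Z,X)$, and then $g$ is an *$F$-epimorphism*. A module $P\in A\text{-mod}$ is *$F$-projective* if $\mathrm{Hom}_A(P,-)$ sends every $F$-exact sequence to an exact sequence. Assume that $F$ has enough projectives, i.e. every module in $A\text{-mod}$ is the target of an $F$-epimorphism from an $F$-projective module. An *$F$-projective cover* of $M$ is an $F$-epimorphism $p:P(M)\to M$ with $P(M)$ $F$-projective such that every endomorphism $h$ of $P(M)$ with $p\circ h=p$ is an automorphism. The *$F$-stable category* of $A\text{-mod}$ has the same objects as $A\text{-mod}$,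 and its morphisms are those of $A\text{-mod}$ modulo the maps that factor through an $F$-projective module. Let $K_F(A)$ be the free abelian group on the isomorphism classes $[M]$ of modules in $A\text{-mod}$ modulo the relations $[N]-[X]-[Y]$ whenever $N\cong X\oplus Y$, and $[P]$ whenever $P$ is $F$-projective. For $M,N\in A\text{-mod}$ the following conditions are equivalent: (a) $\mathrm{Ext}^1_F(M,-)\cong \mathrm{Ext}^1_F(N,-)$ as functors from $A\text{-mod}$ to abelian groups; (b) there are $F$-projective covers $P(M)\to M$ and $P(N)\to N$ with $M\oplus P(N)\cong N\oplus P(M)$ in $A\text{-mod}$; (b') there are $F$-projective modules $P$ and $Q$ with $M\oplus P\cong N\oplus Q$ in $A\text{-mod}$; (c) $M\cong N$ in the $F$-stable category of $A\text{-mod}$; (d) $[M]=[N]$ in $K_F(A)$. -/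

import Mathlib

open CategoryTheory CategoryTheory.Abelian

universe u

noncomputable section

namespace RelHom

variable {A : Type u} [Ring A]

/-- An additive subbifunctor `F` of `Ext¹_A(-,-)` on the category `A-mod` of finitely generated
left `A`-modules: a subgroup `F(M, N) ⊆ Ext¹_A(M, N)` for all `M`, `N`, stable under the
functoriality of `Ext¹` in both variables (pushouts and pullbacks of extensions). -/
structure ExtSubbifunctor (A : Type u) [Ring A] where
  /-- The subgroup `F(M, N)` of `Ext¹_A(M, N)`. -/
  sub (M N : FGModuleCat.{u} A) : AddSubgroup (Ext.{u} M.obj N.obj 1)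
  /-- Stability under pushout along a morphism of the second variable. -/
  push {M N N' : FGModuleCat.{u} A} (g : N ⟶ N') {e : Ext.{u} M.obj N.obj 1}
    (he : e ∈ sub M N) : e.comp (Ext.mk₀ g.hom) (add_zero 1) ∈ sub M N'
  /-- Stability under pullback along a morphism of the first variable. -/
  pull {M M' N : FGModuleCat.{u} A} (f : M' ⟶ M) {e : Ext.{u} M.obj N.obj 1}
    (he : e ∈ sub M N) : (Ext.mk₀ f.hom).comp e (zero_add 1) ∈ sub M' N

variable (F : ExtSubbifunctor A)

/-- A sequence `0 ⟶ X ⟶ Y ⟶ Z ⟶ 0` of finitely generated modules is `F`-exact if it is exact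
and its class in `Ext¹_A(Z, X)` lies in `F(Z, X)`. -/
def FExact (S : ShortComplex (FGModuleCat.{u} A)) : Prop :=
  ∃ h : (S.map (ModuleCat.isFG.{u} A).ι).ShortExact, h.extClass ∈ F.sub S.X₃ S.X₁

/-- `P` is `F`-projective if `Hom_A(P, -)` sends `F`-exact sequences to exact ones; as
`Hom_A(P, -)` is left exact, this is the surjectivity of `Hom_A(P, Y) ⟶ Hom_A(P, Z)`. -/
def FProjective (P : FGModuleCat.{u} A) : Prop :=
  ∀ S : ShortComplex (FGModuleCat.{u} A), FExact F S →
    ∀ f : P ⟶ S.X₃, ∃ g : P ⟶ S.X₂, g ≫ S.g = f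

/-- A morphism is an `F`-epimorphism if it is the second map of an `F`-exact sequence. -/
def FEpi {Y Z : FGModuleCat.{u} A} (p : Y ⟶ Z) : Prop :=
  ∃ (X : FGModuleCat.{u} A) (i : X ⟶ Y) (w : i ≫ p = 0), FExact F (ShortComplex.mk i p w)

/-- `F` has enough projectives: each module in `A-mod` is the target of an `F`-epimorphism from
an `F`-projective module. -/
def EnoughFProjectives : Prop :=
  ∀ M : FGModuleCat.{u} A, ∃ (P : FGModuleCat.{u} A) (p : P ⟶ M), FProjective F P ∧ FEpi F p

/-- `p : P ⟶ M` is an `F`-projective cover: `P` is `F`-projective, `p` is an `F`-epimorphism, and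
`p` is right minimal. -/
def IsFProjectiveCover {P M : FGModuleCat.{u} A} (p : P ⟶ M) : Prop :=
  FProjective F P ∧ FEpi F p ∧ ∀ h : P ⟶ P, h ≫ p = p → IsIso h

/-- The direct sum of two finitely generated modules. -/
abbrev dsum (M N : FGModuleCat.{u} A) : FGModuleCat.{u} A := FGModuleCat.of A (M × N)

/-- The functor `Ext¹_F(M, -) = F(M, -) : A-mod ⥤ Ab`. -/
def extF (M : FGModuleCat.{u} A) : FGModuleCat.{u} A ⥤ AddCommGrpCat.{u} where
  obj N := AddCommGrpCat.of (F.sub M N)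
  map {N N'} g := AddCommGrpCat.ofHom
    ((((Ext.mk₀ g.hom).postcomp M.obj (add_zero 1)).comp (F.sub M N).subtype).codRestrict
      (F.sub M N') (fun e => F.push g e.2))
  map_id N := by
    ext e
    exact Ext.comp_mk₀_id (e : Ext.{u} M.obj N.obj 1)
  map_comp {N N' N''} g g' := by
    ext e
    change (e : Ext.{u} M.obj N.obj 1).comp (Ext.mk₀ (g ≫ g').hom) (add_zero 1) =
      ((e : Ext.{u} M.obj N.obj 1).comp (Ext.mk₀ g.hom) (add_zero 1)).comp
        (Ext.mk₀ g'.hom) (add_zero 1)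
    rw [ObjectProperty.FullSubcategory.comp_hom, ← Ext.mk₀_comp_mk₀]
    symm
    apply Ext.comp_assoc
    lia

/-- Two parallel morphisms are `F`-stably equal if their difference factors through an
`F`-projective module. -/
def stableRel : HomRel (FGModuleCat.{u} A) := fun X Y f g =>
  ∃ (P : FGModuleCat.{u} A) (a : X ⟶ P) (b : P ⟶ Y), FProjective F P ∧ f - g = a ≫ b

/-- A direct sum of `F`-projective modules is `F`-projective. -/
lemma FProjective.dsum {P Q : FGModuleCat.{u} A} (hP : FProjective F P) (hQ : FProjective F Q) :
    FProjective F (dsum P Q) := by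
  intro S hS f
  obtain ⟨g₁, h₁⟩ := hP S hS (FGModuleCat.ofHom (LinearMap.inl A P Q) ≫ f)
  obtain ⟨g₂, h₂⟩ := hQ S hS (FGModuleCat.ofHom (LinearMap.inr A P Q) ≫ f)
  refine ⟨FGModuleCat.ofHom (LinearMap.fst A P Q) ≫ g₁ +
    FGModuleCat.ofHom (LinearMap.snd A P Q) ≫ g₂, ?_⟩
  rw [Preadditive.add_comp, Category.assoc, Category.assoc, h₁, h₂]
  apply FGModuleCat.hom_ext
  apply LinearMap.ext
  rintro ⟨x, y⟩
  change f.hom.hom (x, 0) + f.hom.hom (0, y) = f.hom.hom (x, y)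
  rw [← map_add]
  simp

/-- The zero module is `F`-projective. -/
lemma FProjective.punit : FProjective F (FGModuleCat.of A PUnit) := by
  intro S _ f
  refine ⟨0, ?_⟩
  ext x
  have hx : x = 0 := Subsingleton.elim (α := PUnit) _ _
  rw [hx, map_zero, map_zero]

/-- `F`-stable equality is a congruence, so that the morphisms of the quotient category by it are
exactly the groups `Hom_A(X, Y)` modulo the maps that factor through `F`-projective modules. -/
instance : Congruence (stableRel F) where
  comp_left := by
    rintro X Y Z f g g' ⟨P, a, b, hP, h⟩
    exact ⟨P, f ≫ a, b, hP, by rw [← Preadditive.comp_sub, h, Category.assoc]⟩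
  comp_right := by
    rintro X Y Z f f' g ⟨P, a, b, hP, h⟩
    exact ⟨P, a, b ≫ g, hP, by rw [← Preadditive.sub_comp, h, Category.assoc]⟩
  equivalence :=
    { refl := fun f => ⟨_, 0, 0, FProjective.punit F, by simp⟩
      symm := fun {f g} ⟨P, a, b, hP, h⟩ =>
        ⟨P, -a, b, hP, by rw [Preadditive.neg_comp, ← h, neg_sub]⟩
      trans := fun {f g k} h₁ h₂ => by
        obtain ⟨P, a, b, hP, h⟩ := h₁
        obtain ⟨Q, c, d, hQ, h'⟩ := h₂
        refine ⟨_, FGModuleCat.ofHom (a.hom.hom.prod c.hom.hom),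
          FGModuleCat.ofHom (b.hom.hom.coprod d.hom.hom), hP.dsum F hQ, ?_⟩
        rw [← sub_add_sub_cancel f g k, h, h']
        ext x
        rfl }

/-- The `F`-stable category of `A-mod`: same objects, morphisms modulo those that factor through
`F`-projective modules. -/
abbrev FStable := CategoryTheory.Quotient (stableRel F)

/-- A finitely generated module, as an object of the `F`-stable category. -/
abbrev toFStable (M : FGModuleCat.{u} A) : FStable F :=
  (CategoryTheory.Quotient.functor (stableRel F)).obj M

/-- The type of isomorphism classes of finitely generated `A`-modules. -/
abbrev IsoClass (A : Type u) [Ring A] :=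
  _root_.Quotient (isIsomorphicSetoid (FGModuleCat.{u} A))

/-- The generator of the free abelian group on isomorphism classes given by `M`. -/
def gen (M : FGModuleCat.{u} A) : FreeAbelianGroup (IsoClass A) :=
  FreeAbelianGroup.of (Quotient.mk (isIsomorphicSetoid (FGModuleCat.{u} A)) M)

/-- The relations of `K_F(A)`: `[N] - [X] - [Y]` whenever `N ≅ X ⊕ Y`, and `[P]` whenever `P` is
`F`-projective. -/
def relKF : Set (FreeAbelianGroup (IsoClass A)) :=
  {x | ∃ N X Y : FGModuleCat.{u} A, Nonempty (N ≅ dsum X Y) ∧ x = gen N - gen X - gen Y} ∪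
    {x | ∃ P : FGModuleCat.{u} A, FProjective F P ∧ x = gen P}

/-- The group `K_F(A)`. -/
abbrev KF := FreeAbelianGroup (IsoClass A) ⧸ AddSubgroup.closure (relKF F)

/-- The class `[M]` in `K_F(A)`. -/
def classKF (M : FGModuleCat.{u} A) : KF F := QuotientAddGroup.mk (gen M)

end RelHom

end

/-!
Let `0 ⟶ K ⟶ P ⟶ M ⟶ 0` be `F`-exact with `P` an `F`-projective module. Every element of `F(M, X)`
is a pushout of its class, so a natural transformation `F(M, -) ⟶ F(N, -)` is determined by the
image of this class, and that image is the pullback of the class along a map `N ⟶ M`, unique up to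
maps that factor through `P`. Thus `M ↦ F(M, -)` is a contravariant fully faithful functor on the
`F`-stable category, which gives the equivalence of (a) and (c).

If `f : M ⟶ N` and `g : N ⟶ M` are inverse to each other in the `F`-stable category, then
`𝟙 M - f ≫ g` factors through an `F`-projective module `Q`. The factors complete `f` and `g` to an
inclusion and retraction of `M` as a direct summand of `N ⊕ Q`, and the complement is
`F`-projective. So (c) implies (b').

Over an artinian ring, indecomposable finitely generated modules have local endomorphism rings by
Fitting's lemma, so finitely generated modules cancel from direct sums. Since `P(M) ⊕ P` and
`P(N) ⊕ Q` are `F`-projective covers of `M ⊕ P ≅ N ⊕ Q`, cancellation yields (b) from (b').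
Moreover the cancellative monoid of isomorphism classes embeds into its group completion, of which
`K_F(A)` is the quotient by the subgroup of differences `[P] - [Q]` with `P` and `Q` both
`F`-projective; hence (b') and (d) are equivalent.
-/

noncomputable section

open Limits

namespace RelHom

section LocalEndomorphismRing

instance isDedekindFiniteMonoid_of_isLocalRing {R : Type*} [Ring R] [IsLocalRing R] :
    IsDedekindFiniteMonoid R where
  mul_eq_one_symm {a b} hab := by
    have hidem : (b * a) * (b * a) = b * a := by rw [mul_assoc, ← mul_assoc a, hab, one_mul]
    have hadd : IsUnit (b * a + (1 - b * a)) := by rw [add_sub_cancel]; exact isUnit_one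
    rcases IsLocalRing.isUnit_or_isUnit_of_isUnit_add hadd with h | h
    · exact h.mul_left_cancel (hidem.trans (mul_one _).symm)
    · have hba : b * a = 0 := by
        refine h.mul_left_cancel ?_
        rw [sub_mul, one_mul, hidem, sub_self, mul_zero]
      have hone : (1 : R) = 0 := by
        rw [← mul_one (1 : R), ← hab, mul_assoc, ← mul_assoc b, hba, zero_mul, mul_zero]
      exact absurd hone one_ne_zero

variable {C : Type*} [Category C] [Preadditive C] [HasBinaryBiproducts C]

lemma nonempty_iso_of_biprod_iso_of_isLocalRing_end {X Y Z : C} [IsLocalRing (End X)]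
    (φ : X ⊞ Y ≅ X ⊞ Z) : Nonempty (Y ≅ Z) := by
  let a : End X := biprod.inl ≫ φ.hom ≫ biprod.fst
  let a' : End X := biprod.inl ≫ φ.inv ≫ biprod.fst
  let b : Y ⟶ X := biprod.inr ≫ φ.hom ≫ biprod.fst
  let b' : X ⟶ Y := biprod.inl ≫ φ.inv ≫ biprod.snd
  let c : End X := b' ≫ b
  have hsum : a * a' + c = 1 := by
    calc a * a' + c
        = biprod.inl ≫ φ.inv ≫ (biprod.fst ≫ biprod.inl + biprod.snd ≫ biprod.inr) ≫
            φ.hom ≫ biprod.fst := by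
          simp only [End.mul_def, Preadditive.add_comp, Preadditive.comp_add, Category.assoc,
            a, a', b, b', c]
      _ = 𝟙 X := by simp
  by_cases ha : IsUnit a
  · have : IsIso (biprod.inl ≫ φ.hom ≫ biprod.fst) := (isUnit_iff_isIso a).1 ha
    exact ⟨Biprod.isoElim φ⟩
  · have hc : IsUnit c :=
      (IsLocalRing.isUnit_or_isUnit_of_isUnit_add (hsum ▸ isUnit_one)).resolve_left
        fun h => ha (isUnit_of_mul_isUnit_left h)
    have hac : IsUnit (a + c) := by
      rw [← neg_add_cancel_left a c] at hc
      exact (IsLocalRing.isUnit_or_isUnit_of_isUnit_add hc).resolve_left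
        fun h => ha (IsUnit.neg_iff a |>.1 h)
    -- a column operation replaces the corner `a` of the matrix of `φ` by `a + c`
    let ψ : X ⊞ Y ≅ X ⊞ Z := Biprod.unipotentUpper b' ≪≫ φ
    have hψ : biprod.inl ≫ ψ.hom ≫ biprod.fst = a + c := by
      simp [ψ, a, b, c, Biprod.ofComponents]
    have : IsIso (biprod.inl ≫ ψ.hom ≫ biprod.fst) := hψ ▸ (isUnit_iff_isIso _).1 hac
    exact ⟨Biprod.isoElim ψ⟩

end LocalEndomorphismRing

section Biproducts

variable {C : Type*} [Category C] [Preadditive C] [HasBinaryBiproducts C]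

/-- A decomposition of the identity of `X` into two orthogonal retractions exhibits `X` as a
biproduct. -/
def biprodIsoOfRetracts {X Y Z : C} {i : Y ⟶ X} {r : X ⟶ Y} {j : Z ⟶ X}
    {s : X ⟶ Z} (hir : i ≫ r = 𝟙 Y) (hjs : j ≫ s = 𝟙 Z) (h : r ≫ i + s ≫ j = 𝟙 X) :
    X ≅ Y ⊞ Z where
  hom := biprod.lift r s
  inv := biprod.desc i j
  hom_inv_id := by rw [biprod.lift_desc, h]
  inv_hom_id := by
    have his : i ≫ s = 0 := by
      have := i ≫= h =≫ s
      simpa [reassoc_of% hir, hjs] using this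
    have hjr : j ≫ r = 0 := by
      have := j ≫= h =≫ r
      simpa [reassoc_of% hjs, hir] using this
    ext <;> simp [hir, hjs, his, hjr]

lemma isIso_of_comp_snd_eq_snd {X Y : C} {h : X ⊞ Y ⟶ X ⊞ Y} (hsnd : h ≫ biprod.snd = biprod.snd)
    [IsIso (biprod.inl ≫ h ≫ biprod.fst)] : IsIso h := by
  let a : X ≅ X := asIso (biprod.inl ≫ h ≫ biprod.fst)
  let c : Y ⟶ X := biprod.inr ≫ h ≫ biprod.fst
  have hh : h = (biprod.mapIso a (Iso.refl Y) ≪≫ Biprod.unipotentLower c).hom := by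
    ext <;> simp [a, c, hsnd, Biprod.ofComponents]
  rw [hh]
  infer_instance

end Biproducts

section FiniteLength

lemma exists_isIdempotentElem_pow_mul_eq {R X : Type*} [Ring R] [AddCommGroup X] [Module R X]
    [IsArtinian R X] [IsNoetherian R X] (f : Module.End R X) :
    ∃ (n : ℕ) (e : Module.End R X), IsIdempotentElem e ∧ f ^ n * e = f ^ n ∧
      (IsUnit e → IsUnit f) := by
  obtain ⟨n, hn, hn0⟩ := (f.eventually_isCompl_ker_pow_range_pow.and
    (Filter.eventually_ge_atTop 1)).exists
  refine ⟨n, _, Submodule.isIdempotentElem_projection hn.symm, ?_, fun he => ?_⟩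
  · ext x
    have hx := Submodule.sub_projection_mem hn.symm x
    rw [LinearMap.mem_ker, map_sub, sub_eq_zero] at hx
    exact hx.symm
  · rw [Module.End.isUnit_iff] at he ⊢
    apply IsNoetherian.bijective_of_surjective_endomorphism
    have hle : LinearMap.range (f ^ n) ≤ LinearMap.range (f ^ 1) := f.iterateRange.monotone hn0
    rwa [← Submodule.range_projection hn.symm, LinearMap.range_eq_top.2 he.2, pow_one,
      top_le_iff, LinearMap.range_eq_top] at hle

variable {A : Type u} [Ring A]

/-- Endomorphisms in `A-mod` are linear endomorphisms of the underlying module. -/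
def endRingEquiv (X : FGModuleCat.{u} A) : End X ≃+* Module.End A X where
  toFun f := f.hom.hom
  invFun f := FGModuleCat.ofHom f
  map_mul' _ _ := rfl
  map_add' _ _ := rfl

lemma exists_isIdempotentElem_end_pow_mul_eq [IsArtinianRing A] {X : FGModuleCat.{u} A}
    (f : End X) :
    ∃ (n : ℕ) (e : End X), IsIdempotentElem e ∧ f ^ n * e = f ^ n ∧ (IsUnit e → IsUnit f) := by
  obtain ⟨n, e, he, hfe, hef⟩ := exists_isIdempotentElem_pow_mul_eq (endRingEquiv X f)
  obtain ⟨e, rfl⟩ := (endRingEquiv X).surjective e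
  refine ⟨n, e, ?_, (endRingEquiv X).injective (by simp only [map_mul, map_pow, hfe]), fun h => ?_⟩
  · exact (endRingEquiv X).injective (by rw [map_mul, he.eq])
  · simpa using hef (h.map (endRingEquiv X))

lemma isLocalRing_end_of_forall_idempotent [IsArtinianRing A] {X : FGModuleCat.{u} A}
    [Nontrivial (End X)] (hX : ∀ e : X ⟶ X, e ≫ e = e → e = 0 ∨ e = 𝟙 X) :
    IsLocalRing (End X) := by
  refine .of_isUnit_or_isUnit_one_sub_self fun f => ?_
  obtain ⟨n, e, he, hfe, hef⟩ := exists_isIdempotentElem_end_pow_mul_eq f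
  rcases hX e he with rfl | rfl
  · have hf : IsNilpotent f := ⟨n, hfe.symm.trans (mul_zero _)⟩
    exact .inr hf.isUnit_one_sub
  · exact .inl (hef isUnit_one)

lemma length_lt_length_of_retract [IsArtinianRing A] {X Y : FGModuleCat.{u} A} {i : Y ⟶ X}
    {r : X ⟶ Y} (hir : i ≫ r = 𝟙 Y) (hri : r ≫ i ≠ 𝟙 X) :
    Module.length A Y < Module.length A X := by
  have hinj : Function.Injective i.hom.hom :=
    Function.LeftInverse.injective fun y => ConcreteCategory.congr_hom hir y
  rw [(LinearEquiv.ofInjective i.hom.hom hinj).length_eq]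
  refine Submodule.length_lt fun htop => hri ?_
  ext x
  obtain ⟨y, rfl⟩ := LinearMap.range_eq_top.1 htop x
  exact congrArg i.hom.hom (ConcreteCategory.congr_hom hir y)

end FiniteLength

section IsoClasses

variable {A : Type u} [Ring A]

/-- `dsum M N`, with its inclusions and projections, as a biproduct. -/
def dsumBicone (M N : FGModuleCat.{u} A) : BinaryBicone M N where
  pt := dsum M N
  fst := FGModuleCat.ofHom (LinearMap.fst A M N)
  snd := FGModuleCat.ofHom (LinearMap.snd A M N)
  inl := FGModuleCat.ofHom (LinearMap.inl A M N)
  inr := FGModuleCat.ofHom (LinearMap.inr A M N)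

/-- The universal properties of `dsumBicone`. -/
def dsumBiconeIsBilimit (M N : FGModuleCat.{u} A) : (dsumBicone M N).IsBilimit :=
  isBinaryBilimitOfTotal _ <| FGModuleCat.hom_ext <| LinearMap.ext fun x =>
    LinearMap.congr_fun (LinearMap.coprod_inl_inr (R := A) (M := M) (M₂ := N)) x

instance : HasBinaryBiproducts (FGModuleCat.{u} A) where
  has_binary_biproduct M N := .mk ⟨dsumBicone M N, dsumBiconeIsBilimit M N⟩

/-- `dsum M N` is the chosen biproduct of the category `A-mod`. -/
def dsumIsoBiprod (M N : FGModuleCat.{u} A) : dsum M N ≅ M ⊞ N :=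
  biprod.uniqueUpToIso M N (dsumBiconeIsBilimit M N)

/-- The isomorphism class of a module. -/
def isoClass (M : FGModuleCat.{u} A) : IsoClass A := Quotient.mk _ M

lemma isoClass_eq_iff {M N : FGModuleCat.{u} A} :
    isoClass M = isoClass N ↔ Nonempty (M ≅ N) := Quotient.eq

instance : Zero (IsoClass A) := ⟨isoClass (FGModuleCat.of A PUnit)⟩

instance : Add (IsoClass A) :=
  ⟨Quotient.map₂ dsum fun _ _ ⟨e⟩ _ _ ⟨e'⟩ =>
    ⟨((FGModuleCat.isoToLinearEquiv e).prodCongr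
      (FGModuleCat.isoToLinearEquiv e')).toFGModuleCatIso⟩⟩

/-- Isomorphism classes of modules, with direct sum as addition. -/
instance : AddCommMonoid (IsoClass A) where
  add_assoc := by
    rintro ⟨X⟩ ⟨Y⟩ ⟨Z⟩
    exact Quotient.sound ⟨(LinearEquiv.prodAssoc A X Y Z).toFGModuleCatIso⟩
  zero_add := by
    rintro ⟨X⟩
    exact Quotient.sound ⟨(LinearEquiv.uniqueProd (R := A) (M := X)).toFGModuleCatIso⟩
  add_zero := by
    rintro ⟨X⟩
    exact Quotient.sound ⟨(LinearEquiv.prodUnique (R := A) (M := X)).toFGModuleCatIso⟩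
  add_comm := by
    rintro ⟨X⟩ ⟨Y⟩
    exact Quotient.sound ⟨(LinearEquiv.prodComm A X Y).toFGModuleCatIso⟩
  nsmul := nsmulRec

lemma isoClass_dsum (M N : FGModuleCat.{u} A) :
    isoClass (dsum M N) = isoClass M + isoClass N := rfl

lemma isoClass_biprod (M N : FGModuleCat.{u} A) :
    isoClass (M ⊞ N) = isoClass M + isoClass N :=
  isoClass_eq_iff.2 ⟨(dsumIsoBiprod M N).symm⟩

lemma eq_of_isoClass_add_eq_add [IsArtinianRing A] {X Y Z : FGModuleCat.{u} A}
    (h : isoClass X + isoClass Y = isoClass X + isoClass Z) : isoClass Y = isoClass Z := by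
  induction hn : Module.length A X using WellFoundedLT.induction generalizing X Y Z with
  | ind n ih =>
    subst hn
    cases subsingleton_or_nontrivial (End X) with
    | inl hX =>
      have hX : IsZero X := (IsZero.iff_id_eq_zero X).2 (Subsingleton.elim (α := End X) _ _)
      simp only [← isoClass_biprod, isoClass_eq_iff] at h ⊢
      obtain ⟨φ⟩ := h
      exact ⟨isoZeroBiprod hX ≪≫ φ ≪≫ (isoZeroBiprod hX).symm⟩
    | inr hX =>
      by_cases hidem : ∀ e : X ⟶ X, e ≫ e = e → e = 0 ∨ e = 𝟙 X
      · have := isLocalRing_end_of_forall_idempotent hidem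
        simp only [← isoClass_biprod, isoClass_eq_iff] at h ⊢
        obtain ⟨φ⟩ := h
        exact nonempty_iso_of_biprod_iso_of_isLocalRing_end φ
      · push Not at hidem
        obtain ⟨e, he, he0, he1⟩ := hidem
        obtain ⟨U, i, r, hir, hri⟩ := IsIdempotentComplete.idempotents_split X e he
        obtain ⟨V, j, s, hjs, hsj⟩ := IsIdempotentComplete.idempotents_split X (𝟙 X - e)
          (Idempotents.idem_of_id_sub_idem e he)
        have hX : isoClass X = isoClass U + isoClass V := by
          rw [← isoClass_biprod, isoClass_eq_iff]
          exact ⟨biprodIsoOfRetracts hir hjs (by rw [hri, hsj, add_sub_cancel])⟩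
        rw [hX, add_assoc, add_assoc] at h
        have hU := length_lt_length_of_retract hir (hri ▸ he1)
        have hV := length_lt_length_of_retract hjs (hsj ▸ mt sub_eq_self.1 he0)
        exact ih _ hV (ih _ hU h rfl) rfl

instance [IsArtinianRing A] : IsCancelAdd (IsoClass A) :=
  have : IsLeftCancelAdd (IsoClass A) :=
    ⟨by rintro ⟨X⟩ ⟨Y⟩ ⟨Z⟩ h; exact eq_of_isoClass_add_eq_add h⟩
  AddCommMagma.IsLeftCancelAdd.toIsCancelAdd _

end IsoClasses

section Ext

variable {C : Type*} [Category C] [Abelian C]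

lemma shortExact_of_isPushout {S : ShortComplex C} (hS : S.ShortExact) {X Y : C} {k : S.X₁ ⟶ X}
    {l : S.X₂ ⟶ Y} {i : X ⟶ Y} {p : Y ⟶ S.X₃} (sq : IsPushout S.f k l i) (w : i ≫ p = 0)
    (hp : l ≫ p = S.g) : (ShortComplex.mk i p w).ShortExact := by
  have := hS.epi_g
  have : Epi p := epi_of_epi_fac hp
  have : Mono i := (MorphismProperty.monomorphisms C).of_isPushout sq.flip hS.mono_f
  refine ⟨ShortComplex.exact_of_g_is_cokernel _ <| CokernelCofork.IsColimit.ofπ' _ _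
    fun {W} (m : Y ⟶ W) (hm : i ≫ m = 0) => ?_⟩
  have hlm : S.f ≫ l ≫ m = 0 := by rw [sq.w_assoc, hm, comp_zero]
  refine ⟨hS.exact.desc _ hlm, sq.hom_ext ?_ ?_⟩
  · simp only [reassoc_of% hp, hS.exact.g_desc]
  · simp only [reassoc_of% w, zero_comp, hm]

variable [HasExt C]

lemma mk₀_comp_sub_mk₀_comp {X Y Z : C} (f g : X ⟶ Y) (e : Ext Y Z 1) :
    (Ext.mk₀ f).comp e (zero_add 1) - (Ext.mk₀ g).comp e (zero_add 1) =
      (Ext.mk₀ (f - g)).comp e (zero_add 1) := by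
  rw [sub_eq_add_neg, sub_eq_add_neg, Ext.mk₀_add, Ext.mk₀_neg, Ext.add_comp, Ext.neg_comp]

lemma extClass_eq_comp_mk₀ {S : ShortComplex C} (hS : S.ShortExact) {X Y : C} {k : S.X₁ ⟶ X}
    {l : S.X₂ ⟶ Y} {i : X ⟶ Y} {p : Y ⟶ S.X₃} {w : i ≫ p = 0}
    (hT : (ShortComplex.mk i p w).ShortExact) (hk : k ≫ i = S.f ≫ l) (hp : l ≫ p = S.g) :
    hT.extClass = hS.extClass.comp (Ext.mk₀ k) (add_zero 1) := by
  let φ : S ⟶ ShortComplex.mk i p w :=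
    { τ₁ := k, τ₂ := l, τ₃ := 𝟙 S.X₃, comm₁₂ := hk, comm₂₃ := by rw [Category.comp_id, hp] }
  exact (Ext.mk₀_id_comp _).symm.trans (ShortComplex.ShortExact.extClass_naturality hS hT φ).symm

lemma exists_extClass_comp_mk₀_eq {S : ShortComplex C} (hS : S.ShortExact) {X : C}
    (e : Ext S.X₃ X 1) (he : (Ext.mk₀ S.g).comp e (zero_add 1) = 0) :
    ∃ k : S.X₁ ⟶ X, hS.extClass.comp (Ext.mk₀ k) (add_zero 1) = e := by
  obtain ⟨x, hx⟩ := Ext.contravariant_sequence_exact₃ hS X e he (add_zero 1)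
  obtain ⟨k, rfl⟩ := Ext.addEquiv₀.symm.surjective x
  exact ⟨k, hx⟩

lemma exists_mk₀_comp_extClass_eq {S : ShortComplex C} (hS : S.ShortExact) {X : C}
    (e : Ext X S.X₁ 1) (he : e.comp (Ext.mk₀ S.f) (add_zero 1) = 0) :
    ∃ f : X ⟶ S.X₃, (Ext.mk₀ f).comp hS.extClass (zero_add 1) = e := by
  obtain ⟨x, hx⟩ := Ext.covariant_sequence_exact₁ X hS e he (zero_add 1)
  obtain ⟨f, rfl⟩ := Ext.addEquiv₀.symm.surjective x
  exact ⟨f, hx⟩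

lemma mk₀_comp_extClass_eq_zero_iff {S : ShortComplex C} (hS : S.ShortExact) {X : C}
    (f : X ⟶ S.X₃) :
    (Ext.mk₀ f).comp hS.extClass (zero_add 1) = 0 ↔ ∃ k : X ⟶ S.X₂, k ≫ S.g = f := by
  constructor
  · intro hf
    obtain ⟨x, hx⟩ := Ext.covariant_sequence_exact₃ X hS (Ext.mk₀ f) (zero_add 1) hf
    obtain ⟨k, rfl⟩ := Ext.addEquiv₀.symm.surjective x
    exact ⟨k, (Ext.mk₀_bijective _ _).1 ((Ext.mk₀_comp_mk₀ _ _).symm.trans hx)⟩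
  · rintro ⟨k, rfl⟩
    rw [← Ext.mk₀_comp_mk₀, Ext.comp_assoc_of_second_deg_zero, hS.comp_extClass, Ext.comp_zero]

lemma exists_extClass_eq [EnoughProjectives C] {X Z : C} (e : Ext Z X 1) :
    ∃ (Y : C) (i : X ⟶ Y) (p : Y ⟶ Z) (w : i ≫ p = 0)
      (h : (ShortComplex.mk i p w).ShortExact), h.extClass = e := by
  let S : ShortComplex C := .mk _ _ (kernel.condition (Projective.π Z))
  have hS : S.ShortExact :=
    { exact := ShortComplex.exact_of_f_is_kernel _ (kernelIsKernel S.g) }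
  obtain ⟨k, rfl⟩ := exists_extClass_comp_mk₀_eq hS e (Ext.eq_zero_of_projective _)
  have hp : pushout.inl S.f k ≫ pushout.desc S.g 0 (by simp) = S.g := pushout.inl_desc _ _ _
  have hw : pushout.inr S.f k ≫ pushout.desc S.g 0 (by simp) = 0 := pushout.inr_desc _ _ _
  have hT := shortExact_of_isPushout hS (.of_hasPushout S.f k) hw hp
  exact ⟨_, _, _, hw, hT, extClass_eq_comp_mk₀ hS hT pushout.condition.symm hp⟩

end Ext

section FProjective

variable {A : Type u} [Ring A] {F : ExtSubbifunctor A}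

lemma FEpi.exists_lift {P Y Z : FGModuleCat.{u} A} {p : Y ⟶ Z} (hp : FEpi F p)
    (hP : FProjective F P) (f : P ⟶ Z) : ∃ g : P ⟶ Y, g ≫ p = f := by
  obtain ⟨X, i, w, h⟩ := hp
  exact hP _ h f

lemma FProjective.of_retract {P Q : FGModuleCat.{u} A} (hP : FProjective F P) {i : Q ⟶ P}
    {r : P ⟶ Q} (hir : i ≫ r = 𝟙 Q) : FProjective F Q := by
  intro S hS f
  obtain ⟨g, hg⟩ := hP S hS (r ≫ f)
  exact ⟨i ≫ g, by rw [Category.assoc, hg, reassoc_of% hir]⟩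

lemma FProjective.biprod {P Q : FGModuleCat.{u} A} (hP : FProjective F P)
    (hQ : FProjective F Q) : FProjective F (P ⊞ Q) :=
  (hP.dsum F hQ).of_retract (dsumIsoBiprod P Q).inv_hom_id

lemma FProjective.eq_zero {P X : FGModuleCat.{u} A} (hP : FProjective F P)
    {e : Ext.{u} P.obj X.obj 1} (he : e ∈ F.sub P X) : e = 0 := by
  obtain ⟨Y, i, p, w, h, rfl⟩ := exists_extClass_eq e
  have : Module.Finite A P.obj := P.property
  have : Module.Finite A X.obj := X.property
  have hY : Module.Finite A Y := .of_exact
    ((ShortComplex.ShortExact.moduleCat_exact_iff_function_exact _).1 h.exact)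
    h.moduleCat_surjective_g
  let S : ShortComplex (FGModuleCat.{u} A) :=
    .mk (X₁ := X) (X₂ := ⟨Y, hY⟩) (X₃ := P) ⟨i⟩ ⟨p⟩ (ObjectProperty.hom_ext _ w)
  obtain ⟨s, hs⟩ := hP S ⟨h, he⟩ (𝟙 P)
  rw [← Ext.mk₀_id_comp h.extClass]
  exact (mk₀_comp_extClass_eq_zero_iff h _).2 ⟨s.hom, congrArg (·.hom) hs⟩

lemma shortExact_map_ι [IsNoetherianRing A] {S : ShortComplex (FGModuleCat.{u} A)}
    (hS : S.ShortExact) : (S.map (ModuleCat.isFG.{u} A).ι).ShortExact :=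
  have : PreservesFiniteLimits (ModuleCat.isFG.{u} A).ι :=
    inferInstanceAs (PreservesFiniteLimits (forget₂ (FGModuleCat A) (ModuleCat.{u} A)))
  have : PreservesFiniteColimits (ModuleCat.isFG.{u} A).ι :=
    inferInstanceAs (PreservesFiniteColimits (forget₂ (FGModuleCat A) (ModuleCat.{u} A)))
  hS.map_of_exact _

lemma FEpi.of_comp [IsNoetherianRing A] {P Q M : FGModuleCat.{u} A} {r : P ⟶ Q} {q : Q ⟶ M}
    (h : FEpi F (r ≫ q)) : FEpi F q := by
  obtain ⟨K, i, w, hex, hmem⟩ := h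
  have : Epi (r ≫ q) := (ModuleCat.isFG.{u} A).ι.epi_of_epi_map hex.epi_g
  have : Epi q := epi_of_epi r q
  have hS := shortExact_map_ι (S := .mk _ _ (kernel.condition q))
    ⟨ShortComplex.exact_of_f_is_kernel _ (kernelIsKernel q)⟩
  let k : K ⟶ kernel q := kernel.lift q (i ≫ r) (by rw [Category.assoc, w])
  have hk : k ≫ kernel.ι q = i ≫ r := kernel.lift_ι _ _ _
  refine ⟨kernel q, kernel.ι q, kernel.condition q, hS, ?_⟩
  have hclass := extClass_eq_comp_mk₀ hex hS (congrArg (·.hom) hk) rfl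
  exact Set.mem_of_eq_of_mem hclass (F.push k hmem)

lemma FEpi.of_forall_exists_lift [IsNoetherianRing A] (hF : EnoughFProjectives F)
    {P M : FGModuleCat.{u} A} {p : P ⟶ M}
    (h : ∀ (Q : FGModuleCat.{u} A) (f : Q ⟶ M), FProjective F Q → ∃ g : Q ⟶ P, g ≫ p = f) :
    FEpi F p := by
  obtain ⟨Q, q, hQ, hq⟩ := hF M
  obtain ⟨g, rfl⟩ := h Q q hQ
  exact hq.of_comp

end FProjective

section StableExt

variable {A : Type u} [Ring A] {F : ExtSubbifunctor A}

lemma extF_hom_ext {M N : FGModuleCat.{u} A} {η θ : extF F M ⟶ extF F N}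
    (h : ∀ (X : FGModuleCat.{u} A) (e : F.sub M X),
      ((η.app X).hom e : F.sub N X) = (θ.app X).hom e) : η = θ :=
  NatTrans.ext (funext fun X => AddCommGrpCat.hom_ext (AddMonoidHom.ext (h X)))

/-- The natural transformation `Ext¹_F(M, -) ⟶ Ext¹_F(N, -)` given by pullback along `N ⟶ M`. -/
def extFMap {M N : FGModuleCat.{u} A} (f : N ⟶ M) : extF F M ⟶ extF F N where
  app X := AddCommGrpCat.ofHom
    ((((Ext.mk₀ f.hom).precomp X.obj (zero_add 1)).comp (F.sub M X).subtype).codRestrict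
      (F.sub N X) fun e => F.pull f e.2)
  naturality X Y g := by
    ext e
    exact Subtype.ext
      (Ext.comp_assoc_of_third_deg_zero (Ext.mk₀ f.hom) e.1 (Ext.mk₀ g.hom) (zero_add 1)).symm

lemma extFMap_id (M : FGModuleCat.{u} A) : extFMap (F := F) (𝟙 M) = 𝟙 _ :=
  extF_hom_ext fun _ e => Subtype.ext (Ext.mk₀_id_comp e.1)

lemma extFMap_comp {M N L : FGModuleCat.{u} A} (f : N ⟶ M) (g : L ⟶ N) :
    extFMap (F := F) (g ≫ f) = extFMap f ≫ extFMap g :=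
  extF_hom_ext fun _ e => Subtype.ext <|
    (congrArg (fun x => x.comp e.1 (zero_add 1)) (Ext.mk₀_comp_mk₀ g.hom f.hom)).symm.trans
      (Ext.comp_assoc_of_second_deg_zero _ _ _ (zero_add 1))

lemma extFMap_eq_of_stableRel {M N : FGModuleCat.{u} A} {f g : N ⟶ M} (h : stableRel F f g) :
    extFMap (F := F) f = extFMap g := by
  obtain ⟨P, a, b, hP, h⟩ := h
  refine extF_hom_ext fun X e => Subtype.ext ?_
  change (Ext.mk₀ f.hom).comp e.1 (zero_add 1) = (Ext.mk₀ g.hom).comp e.1 (zero_add 1)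
  have hab : f.hom - g.hom = a.hom ≫ b.hom := congrArg (·.hom) h
  rw [← sub_eq_zero, mk₀_comp_sub_mk₀_comp, hab, ← Ext.mk₀_comp_mk₀,
    Ext.comp_assoc_of_second_deg_zero, hP.eq_zero (F.pull b e.2),
    Ext.comp_zero]

lemma FExact.stableRel_of_extFMap_eq {S : ShortComplex (FGModuleCat.{u} A)} (hS : FExact F S)
    (hP : FProjective F S.X₂) {N : FGModuleCat.{u} A} {f g : N ⟶ S.X₃}
    (hfg : extFMap (F := F) f = extFMap g) : stableRel F f g := by
  obtain ⟨h, hmem⟩ := hS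
  have hclass : (Ext.mk₀ f.hom).comp h.extClass (zero_add 1) =
      (Ext.mk₀ g.hom).comp h.extClass (zero_add 1) :=
    congrArg (fun η : extF F S.X₃ ⟶ extF F N =>
      ((η.app S.X₁).hom (⟨h.extClass, hmem⟩ : F.sub S.X₃ S.X₁) : F.sub N S.X₁).1) hfg
  obtain ⟨k, hk⟩ := (mk₀_comp_extClass_eq_zero_iff h (f.hom - g.hom)).1
    ((mk₀_comp_sub_mk₀_comp _ _ _).symm.trans (sub_eq_zero.2 hclass))
  exact ⟨S.X₂, ⟨k⟩, S.g, hP, ObjectProperty.hom_ext _ hk.symm⟩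

lemma extF_naturality_apply {M N : FGModuleCat.{u} A} (η : extF F M ⟶ extF F N)
    {X Y : FGModuleCat.{u} A} (g : X ⟶ Y) (e : F.sub M X) :
    ((η.app Y).hom (⟨_, F.push g e.2⟩ : F.sub M Y) : F.sub N Y).1 =
      ((η.app X).hom e : F.sub N X).1.comp (Ext.mk₀ g.hom) (add_zero 1) := by
  have h := congrArg (fun φ => φ.hom e) (η.naturality g)
  rw [AddCommGrpCat.hom_comp, AddCommGrpCat.hom_comp] at h
  exact congrArg Subtype.val h

lemma FExact.exists_extFMap_eq {S : ShortComplex (FGModuleCat.{u} A)} (hS : FExact F S)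
    (hP : FProjective F S.X₂) {N : FGModuleCat.{u} A} (η : extF F S.X₃ ⟶ extF F N) :
    ∃ f : N ⟶ S.X₃, extFMap f = η := by
  obtain ⟨h, hmem⟩ := hS
  let ε : F.sub S.X₃ S.X₁ := ⟨h.extClass, hmem⟩
  have hη (X : FGModuleCat.{u} A) (g : S.X₁ ⟶ X) (e : F.sub S.X₃ X)
      (he : ε.1.comp (Ext.mk₀ g.hom) (add_zero 1) = e.1) :
      ((η.app X).hom e : F.sub N X).1 =
        ((η.app S.X₁).hom ε : F.sub N S.X₁).1.comp (Ext.mk₀ g.hom) (add_zero 1) := by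
    obtain rfl : (⟨_, F.push g ε.2⟩ : F.sub S.X₃ X) = e := Subtype.ext he
    exact extF_naturality_apply η g ε
  -- The image of `ε` under `η` is killed by `S.f`, hence is the pullback of `ε` along some `f`.
  obtain ⟨f, hf⟩ := exists_mk₀_comp_extClass_eq h ((η.app S.X₁).hom ε : F.sub N S.X₁).1
    ((hη S.X₂ S.f 0 h.extClass_comp).symm.trans
      (congrArg Subtype.val ((η.app S.X₂).hom.map_zero)))
  refine ⟨⟨f⟩, extF_hom_ext fun X e => Subtype.ext ?_⟩
  obtain ⟨k, hk⟩ := exists_extClass_comp_mk₀_eq h e.1 (hP.eq_zero (F.pull S.g e.2))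
  rw [hη X ⟨k⟩ e hk, ← hf]
  change (Ext.mk₀ f).comp e.1 (zero_add 1) = _
  rw [← hk]
  exact (Ext.comp_assoc_of_third_deg_zero _ _ _ (zero_add 1)).symm

variable (F) in
/-- `M ↦ Ext¹_F(M, -)`, as a functor on the `F`-stable category. -/
def stableExtF : FStable F ⥤ (FGModuleCat.{u} A ⥤ AddCommGrpCat.{u})ᵒᵖ :=
  CategoryTheory.Quotient.lift (stableRel F)
    { obj M := .op (extF F M)
      map f := (extFMap f).op
      map_id M := congrArg Quiver.Hom.op (extFMap_id M)
      map_comp g f := congrArg Quiver.Hom.op (extFMap_comp f g) }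
    fun _ _ _ _ h => congrArg Quiver.Hom.op (extFMap_eq_of_stableRel h)

lemma full_stableExtF (hF : EnoughFProjectives F) : (stableExtF F).Full where
  map_surjective := by
    rintro ⟨N⟩ ⟨M⟩ η
    obtain ⟨P, p, hP, X, i, w, hS⟩ := hF M
    obtain ⟨f, hf⟩ := hS.exists_extFMap_eq hP η.unop
    exact ⟨(CategoryTheory.Quotient.functor _).map f, congrArg Quiver.Hom.op hf⟩

lemma faithful_stableExtF (hF : EnoughFProjectives F) : (stableExtF F).Faithful where
  map_injective := by
    rintro ⟨N⟩ ⟨M⟩ f g hfg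
    obtain ⟨f, rfl⟩ := (CategoryTheory.Quotient.functor _).map_surjective f
    obtain ⟨g, rfl⟩ := (CategoryTheory.Quotient.functor _).map_surjective g
    obtain ⟨P, p, hP, X, i, w, hS⟩ := hF M
    exact CategoryTheory.Quotient.sound _
      (hS.stableRel_of_extFMap_eq hP (congrArg Quiver.Hom.unop hfg))

lemma nonempty_extF_iso_iff (hF : EnoughFProjectives F) {M N : FGModuleCat.{u} A} :
    Nonempty (extF F M ≅ extF F N) ↔ Nonempty (toFStable F M ≅ toFStable F N) := by
  have := full_stableExtF hF
  have := faithful_stableExtF hF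
  constructor
  · rintro ⟨φ⟩
    exact ⟨((stableExtF F).preimageIso (X := toFStable F N) (Y := toFStable F M) φ.op).symm⟩
  · rintro ⟨φ⟩
    exact ⟨((stableExtF F).mapIso φ.symm).unop⟩

end StableExt

section FEquivalence

variable {A : Type u} [Ring A] {F : ExtSubbifunctor A}

variable (F) in
/-- The monoid of isomorphism classes of `F`-projective modules. -/
def fProjectiveClasses : AddSubmonoid (IsoClass A) where
  carrier := isoClass '' {P | FProjective F P}
  zero_mem' := ⟨_, FProjective.punit F, rfl⟩
  add_mem' := by
    rintro _ _ ⟨P, hP, rfl⟩ ⟨Q, hQ, rfl⟩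
    exact ⟨_, hP.dsum F hQ, rfl⟩

variable (F) in
/-- `M` and `N` become isomorphic after adding `F`-projective summands. This is expressed in the
monoid of isomorphism classes, where the cancellation property of modules applies. -/
def FEquivalent (M N : FGModuleCat.{u} A) : Prop :=
  ∃ p ∈ fProjectiveClasses F, ∃ q ∈ fProjectiveClasses F, isoClass M + p = isoClass N + q

lemma fEquivalent_iff_exists_iso {M N : FGModuleCat.{u} A} :
    FEquivalent F M N ↔ ∃ P Q : FGModuleCat.{u} A, FProjective F P ∧ FProjective F Q ∧
      Nonempty (dsum M P ≅ dsum N Q) := by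
  constructor
  · rintro ⟨_, ⟨P, hP, rfl⟩, _, ⟨Q, hQ, rfl⟩, h⟩
    exact ⟨P, Q, hP, hQ, isoClass_eq_iff.1 h⟩
  · rintro ⟨P, Q, hP, hQ, h⟩
    exact ⟨_, ⟨P, hP, rfl⟩, _, ⟨Q, hQ, rfl⟩, isoClass_eq_iff.2 h⟩

end FEquivalence

section StableIso

variable {A : Type u} [Ring A] {F : ExtSubbifunctor A}

/-- Adding an `F`-projective summand does not change a module of the `F`-stable category. -/
def toFStableIsoBiprod (M : FGModuleCat.{u} A) {P : FGModuleCat.{u} A} (hP : FProjective F P) :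
    toFStable F M ≅ toFStable F (M ⊞ P) where
  hom := (CategoryTheory.Quotient.functor (stableRel F)).map biprod.inl
  inv := (CategoryTheory.Quotient.functor (stableRel F)).map biprod.fst
  hom_inv_id := by
    rw [← CategoryTheory.Functor.map_comp, biprod.inl_fst, CategoryTheory.Functor.map_id]
  inv_hom_id := by
    rw [← CategoryTheory.Functor.map_comp, ← CategoryTheory.Functor.map_id]
    refine CategoryTheory.Quotient.sound _ ⟨P, -biprod.snd, biprod.inr, hP, ?_⟩
    rw [← biprod.total, sub_add_cancel_left, Preadditive.neg_comp]

lemma exists_fProjective_biprod_iso_of_retract [IsNoetherianRing A] {X Y : FGModuleCat.{u} A}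
    {i : X ⟶ Y} {r : Y ⟶ X} (hir : i ≫ r = 𝟙 X) (hri : stableRel F (𝟙 Y) (r ≫ i)) :
    ∃ P : FGModuleCat.{u} A, FProjective F P ∧ Nonempty (Y ≅ X ⊞ P) := by
  obtain ⟨P, j, s, hjs, hsj⟩ := IsIdempotentComplete.idempotents_split Y (𝟙 Y - r ≫ i)
    (Idempotents.idem_of_id_sub_idem _ (by rw [Category.assoc, reassoc_of% hir]))
  obtain ⟨Q, a, b, hQ, hab⟩ := hri
  refine ⟨P, hQ.of_retract (i := j ≫ a) (r := b ≫ s) ?_,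
    ⟨biprodIsoOfRetracts hir hjs (by rw [hsj, add_sub_cancel])⟩⟩
  calc (j ≫ a) ≫ b ≫ s = j ≫ (s ≫ j) ≫ s := by
        simp only [hsj, hab, Category.assoc]
    _ = 𝟙 P := by rw [Category.assoc, reassoc_of% hjs, hjs]

lemma fEquivalent_of_toFStable_iso [IsNoetherianRing A] {M N : FGModuleCat.{u} A}
    (φ : toFStable F M ≅ toFStable F N) : FEquivalent F M N := by
  let π := CategoryTheory.Quotient.functor (stableRel F)
  obtain ⟨f, hf⟩ := π.map_surjective φ.hom
  obtain ⟨g, hg⟩ := π.map_surjective φ.inv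
  have hfg : π.map (𝟙 M) = π.map (f ≫ g) := by
    rw [π.map_id, π.map_comp, hf, hg, φ.hom_inv_id]
  obtain ⟨Q, a, b, hQ, hab⟩ := (CategoryTheory.Quotient.functor_map_eq_iff (stableRel F) _ _).1 hfg
  -- Correcting `f` and `g` by `a` and `b` makes `M` an honest direct summand of `N ⊞ Q`.
  let i : M ⟶ N ⊞ Q := biprod.lift f a
  let r : N ⊞ Q ⟶ M := biprod.desc g b
  have hir : i ≫ r = 𝟙 M := by rw [biprod.lift_desc, ← hab, add_sub_cancel]
  have hri : stableRel F (𝟙 _) (r ≫ i) := by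
    have : IsIso (π.map biprod.fst) := (toFStableIsoBiprod N hQ).isIso_inv
    have : IsIso (π.map i ≫ π.map biprod.fst) := by
      rw [← π.map_comp, biprod.lift_fst, hf]
      infer_instance
    have : IsIso (π.map i) := IsIso.of_isIso_comp_right _ (π.map biprod.fst)
    rw [← CategoryTheory.Quotient.functor_map_eq_iff (stableRel F), ← cancel_epi (π.map i)]
    exact congrArg π.map (show i ≫ 𝟙 _ = i ≫ r ≫ i by rw [reassoc_of% hir, Category.comp_id])
  obtain ⟨P, hP, ⟨e⟩⟩ := exists_fProjective_biprod_iso_of_retract hir hri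
  refine ⟨isoClass P, ⟨P, hP, rfl⟩, isoClass Q, ⟨Q, hQ, rfl⟩, ?_⟩
  rw [← isoClass_biprod, ← isoClass_biprod, isoClass_eq_iff]
  exact ⟨e.symm⟩

lemma nonempty_toFStable_iso_iff [IsNoetherianRing A] {M N : FGModuleCat.{u} A} :
    Nonempty (toFStable F M ≅ toFStable F N) ↔ FEquivalent F M N := by
  refine ⟨fun ⟨φ⟩ => fEquivalent_of_toFStable_iso φ, fun h => ?_⟩
  obtain ⟨P, Q, hP, hQ, ⟨φ⟩⟩ := fEquivalent_iff_exists_iso.1 h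
  let ψ : M ⊞ P ≅ N ⊞ Q := (dsumIsoBiprod M P).symm ≪≫ φ ≪≫ dsumIsoBiprod N Q
  exact ⟨toFStableIsoBiprod M hP ≪≫
    (CategoryTheory.Quotient.functor (stableRel F)).mapIso ψ ≪≫ (toFStableIsoBiprod N hQ).symm⟩

end StableIso

section Covers

variable {A : Type u} [Ring A] {F : ExtSubbifunctor A}

lemma exists_isFProjectiveCover [IsArtinianRing A] (hF : EnoughFProjectives F)
    (M : FGModuleCat.{u} A) : ∃ (P : FGModuleCat.{u} A) (p : P ⟶ M), IsFProjectiveCover F p := by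
  obtain ⟨P, p, hP, hp⟩ := hF M
  induction hn : Module.length A P using WellFoundedLT.induction generalizing P with
  | ind n ih =>
    subst hn
    by_cases hmin : ∀ h : P ⟶ P, h ≫ p = p → IsIso h
    · exact ⟨P, p, hP, hp, hmin⟩
    push Not at hmin
    obtain ⟨h, hhp, hh⟩ := hmin
    obtain ⟨n, e, he, hhe, heh⟩ := exists_isIdempotentElem_end_pow_mul_eq (End.of h)
    have hpow (m : ℕ) : ((End.of h ^ m : End P) : P ⟶ P) ≫ p = p := by
      induction m with
      | zero => exact Category.id_comp p
      | succ m ihm => rw [pow_succ, End.mul_def, Category.assoc, ihm]; exact hhp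
    have hep : e ≫ p = p := by
      have hen := congrArg (· ≫ p) hhe
      simp only [End.mul_def, Category.assoc] at hen
      rwa [hpow n] at hen
    have he1 : e ≠ 1 := fun h1 => hh ((isUnit_iff_isIso _).1 (heh (h1 ▸ isUnit_one)))
    obtain ⟨Q, i, r, hir, hri⟩ := IsIdempotentComplete.idempotents_split P e he
    have hrip : r ≫ i ≫ p = p := by rw [reassoc_of% hri, hep]
    exact ih _ (length_lt_length_of_retract hir (hri ▸ he1)) Q (i ≫ p) (hP.of_retract hir)
      (FEpi.of_comp (hrip.symm ▸ hp)) rfl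

namespace IsFProjectiveCover

lemma nonempty_iso {P Q M N : FGModuleCat.{u} A} {p : P ⟶ M} {q : Q ⟶ N}
    (hp : IsFProjectiveCover F p) (hq : IsFProjectiveCover F q) (e : M ≅ N) :
    Nonempty (P ≅ Q) := by
  obtain ⟨hP, hpF, hpmin⟩ := hp
  obtain ⟨hQ, hqF, hqmin⟩ := hq
  obtain ⟨a, ha⟩ := hqF.exists_lift hP (p ≫ e.hom)
  obtain ⟨b, hb⟩ := hpF.exists_lift hQ (q ≫ e.inv)
  have hab : IsIso (a ≫ b) := hpmin _ (by
    rw [Category.assoc, hb, reassoc_of% ha, e.hom_inv_id, Category.comp_id])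
  have hba : IsIso (b ≫ a) := hqmin _ (by
    rw [Category.assoc, ha, reassoc_of% hb, e.inv_hom_id, Category.comp_id])
  have : IsSplitMono a := ⟨⟨b ≫ inv (a ≫ b), by rw [← Category.assoc, IsIso.hom_inv_id]⟩⟩
  have : Epi a := epi_of_epi b a
  have : IsIso a := isIso_of_epi_of_isSplitMono a
  exact ⟨asIso a⟩

lemma biprod_map_id [IsNoetherianRing A] (hF : EnoughFProjectives F) {P M Q : FGModuleCat.{u} A}
    {p : P ⟶ M} (hp : IsFProjectiveCover F p) (hQ : FProjective F Q) :
    IsFProjectiveCover F (biprod.map p (𝟙 Q)) := by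
  obtain ⟨hP, hpF, hpmin⟩ := hp
  refine ⟨hP.biprod hQ, .of_forall_exists_lift hF fun T f hT => ?_, fun h hh => ?_⟩
  · obtain ⟨g, hg⟩ := hpF.exists_lift hT (f ≫ biprod.fst)
    exact ⟨biprod.lift g (f ≫ biprod.snd), by
      apply biprod.hom_ext <;> simp [hg]⟩
  · have hfst : h ≫ biprod.fst ≫ p = biprod.fst ≫ p := by simpa using hh =≫ biprod.fst
    have hsnd : h ≫ biprod.snd = biprod.snd := by simpa using hh =≫ biprod.snd
    have : IsIso (biprod.inl ≫ h ≫ biprod.fst) := hpmin _ (by simp [hfst])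
    exact isIso_of_comp_snd_eq_snd hsnd

end IsFProjectiveCover

lemma FEquivalent.nonempty_dsum_iso_of_isFProjectiveCover [IsArtinianRing A]
    (hF : EnoughFProjectives F) {M N PM PN : FGModuleCat.{u} A} {p : PM ⟶ M} {q : PN ⟶ N}
    (h : FEquivalent F M N) (hp : IsFProjectiveCover F p) (hq : IsFProjectiveCover F q) :
    Nonempty (dsum M PN ≅ dsum N PM) := by
  obtain ⟨_, ⟨P, hP, rfl⟩, _, ⟨Q, hQ, rfl⟩, hMN⟩ := h
  have hcover : isoClass PM + isoClass P = isoClass PN + isoClass Q := by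
    simp only [← isoClass_biprod, isoClass_eq_iff] at hMN ⊢
    obtain ⟨φ⟩ := hMN
    exact (hp.biprod_map_id hF hP).nonempty_iso (hq.biprod_map_id hF hQ) φ
  refine isoClass_eq_iff.1 (add_right_cancel (b := isoClass P + isoClass Q) ?_)
  calc isoClass (dsum M PN) + (isoClass P + isoClass Q)
      = (isoClass M + isoClass P) + (isoClass PN + isoClass Q) := by
        rw [isoClass_dsum, add_add_add_comm]
    _ = (isoClass N + isoClass Q) + (isoClass PM + isoClass P) := by rw [hMN, hcover]
    _ = isoClass (dsum N PM) + (isoClass P + isoClass Q) := by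
        rw [isoClass_dsum, add_add_add_comm, add_comm (isoClass P)]

end Covers

section KF

variable {A : Type u} [Ring A] {F : ExtSubbifunctor A}

variable (F) in
/-- The map `[M] ↦ [M]` from the monoid of isomorphism classes to `K_F(A)`. -/
def isoClassToKF : IsoClass A →+ KF F where
  toFun x := QuotientAddGroup.mk (FreeAbelianGroup.of x)
  map_zero' := (QuotientAddGroup.eq_zero_iff _).2 <| AddSubgroup.subset_closure <|
    .inr ⟨_, FProjective.punit F, rfl⟩
  map_add' := by
    rintro ⟨X⟩ ⟨Y⟩
    have h : (QuotientAddGroup.mk (gen (dsum X Y) - gen X - gen Y) : KF F) = 0 :=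
      (QuotientAddGroup.eq_zero_iff _).2 <| AddSubgroup.subset_closure <|
        .inl ⟨_, X, Y, ⟨Iso.refl _⟩, rfl⟩
    rw [sub_sub, QuotientAddGroup.mk_sub, sub_eq_zero] at h
    exact h

lemma isoClassToKF_eq_zero {p : IsoClass A} (hp : p ∈ fProjectiveClasses F) :
    isoClassToKF F p = 0 := by
  obtain ⟨P, hP, rfl⟩ := hp
  exact (QuotientAddGroup.eq_zero_iff _).2 (AddSubgroup.subset_closure (.inr ⟨P, hP, rfl⟩))

variable (A) in
/-- The map from the free abelian group on the isomorphism classes to the group completion of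
their monoid. -/
def freeToGrothendieck :
    FreeAbelianGroup (IsoClass A) →+ Algebra.GrothendieckAddGroup (IsoClass A) :=
  FreeAbelianGroup.lift Algebra.GrothendieckAddGroup.of

lemma freeToGrothendieck_gen (M : FGModuleCat.{u} A) :
    freeToGrothendieck A (gen M) = Algebra.GrothendieckAddGroup.of (isoClass M) :=
  FreeAbelianGroup.lift_apply_of _ _

lemma exists_freeToGrothendieck_eq_sub {x : FreeAbelianGroup (IsoClass A)}
    (hx : x ∈ AddSubgroup.closure (relKF F)) :
    ∃ p ∈ fProjectiveClasses F, ∃ q ∈ fProjectiveClasses F, freeToGrothendieck A x =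
      Algebra.GrothendieckAddGroup.of p - Algebra.GrothendieckAddGroup.of q := by
  induction hx using AddSubgroup.closure_induction with
  | mem x hx =>
    rcases hx with ⟨N, X, Y, hN, rfl⟩ | ⟨P, hP, rfl⟩
    · refine ⟨0, zero_mem _, 0, zero_mem _, ?_⟩
      simp only [map_sub, freeToGrothendieck_gen, isoClass_eq_iff.2 hN, isoClass_dsum, map_add]
      abel
    · exact ⟨isoClass P, ⟨P, hP, rfl⟩, 0, zero_mem _, by
        rw [freeToGrothendieck_gen, map_zero, sub_zero]⟩
  | zero => exact ⟨0, zero_mem _, 0, zero_mem _, by rw [map_zero, sub_self]⟩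
  | add x y _ _ ihx ihy =>
    obtain ⟨p, hp, q, hq, hx⟩ := ihx
    obtain ⟨p', hp', q', hq', hy⟩ := ihy
    exact ⟨p + p', add_mem hp hp', q + q', add_mem hq hq', by
      rw [map_add, hx, hy, map_add, map_add, add_sub_add_comm]⟩
  | neg x _ ih =>
    obtain ⟨p, hp, q, hq, hx⟩ := ih
    exact ⟨q, hq, p, hp, by rw [map_neg, hx, neg_sub]⟩

lemma classKF_eq_iff [IsArtinianRing A] {M N : FGModuleCat.{u} A} :
    classKF F M = classKF F N ↔ FEquivalent F M N := by
  constructor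
  · intro h
    obtain ⟨p, hp, q, hq, hpq⟩ := exists_freeToGrothendieck_eq_sub (QuotientAddGroup.eq.1 h.symm)
    refine ⟨q, hq, p, hp, Algebra.GrothendieckAddGroup.of_injective ?_⟩
    rw [map_add, map_neg, freeToGrothendieck_gen, freeToGrothendieck_gen, neg_add_eq_sub,
      sub_eq_sub_iff_add_eq_add, add_comm (Algebra.GrothendieckAddGroup.of p)] at hpq
    rw [map_add, map_add, hpq]
  · rintro ⟨p, hp, q, hq, h⟩
    have hKF := congrArg (isoClassToKF F) h
    rwa [map_add, map_add, isoClassToKF_eq_zero hp, isoClassToKF_eq_zero hq, add_zero,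
      add_zero] at hKF

end KF

end RelHom

end

theorem proposition4p4_general {A : Type*} [Ring A] [IsArtinianRing A]
    (F : RelHom.ExtSubbifunctor A) (hF : RelHom.EnoughFProjectives F) (M N : FGModuleCat A) :
    List.TFAE [
      Nonempty (RelHom.extF F M ≅ RelHom.extF F N),
      ∃ (PM PN : FGModuleCat A) (p : PM ⟶ M) (q : PN ⟶ N),
        RelHom.IsFProjectiveCover F p ∧ RelHom.IsFProjectiveCover F q ∧
          Nonempty (RelHom.dsum M PN ≅ RelHom.dsum N PM),
      ∃ P Q : FGModuleCat A, RelHom.FProjective F P ∧ RelHom.FProjective F Q ∧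
        Nonempty (RelHom.dsum M P ≅ RelHom.dsum N Q),
      Nonempty (RelHom.toFStable F M ≅ RelHom.toFStable F N),
      RelHom.classKF F M = RelHom.classKF F N] := by
  rw [← RelHom.fEquivalent_iff_exists_iso]
  tfae_have 1 ↔ 4 := RelHom.nonempty_extF_iso_iff hF
  tfae_have 4 ↔ 3 := RelHom.nonempty_toFStable_iso_iff
  tfae_have 5 ↔ 3 := RelHom.classKF_eq_iff
  tfae_have 3 → 2 := fun h => by
    obtain ⟨PM, p, hp⟩ := RelHom.exists_isFProjectiveCover hF M
    obtain ⟨PN, q, hq⟩ := RelHom.exists_isFProjectiveCover hF N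
    exact ⟨PM, PN, p, q, hp, hq, h.nonempty_dsum_iso_of_isFProjectiveCover hF hp hq⟩
  tfae_have 2 → 3 := fun ⟨PM, PN, _, _, hp, hq, h⟩ =>
    RelHom.fEquivalent_iff_exists_iso.2 ⟨PN, PM, hq.1, hp.1, h⟩
  tfae_finish

theorem proposition4p4 {R A : Type*} [CommRing R] [IsArtinianRing R] [Ring A] [Algebra R A]
    [Module.Finite R A] (F : RelHom.ExtSubbifunctor A) (hF : RelHom.EnoughFProjectives F)
    (M N : FGModuleCat A) :
    List.TFAE [
      -- the functors `Ext¹_F(M, -)` and `Ext¹_F(N, -)` are isomorphic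
      Nonempty (RelHom.extF F M ≅ RelHom.extF F N),
      -- `M ⊕ P(N) ≅ N ⊕ P(M)` for `F`-projective covers `P(M)` of `M` and `P(N)` of `N`
      ∃ (PM PN : FGModuleCat A) (p : PM ⟶ M) (q : PN ⟶ N),
        RelHom.IsFProjectiveCover F p ∧ RelHom.IsFProjectiveCover F q ∧
          Nonempty (RelHom.dsum M PN ≅ RelHom.dsum N PM),
      -- `M ⊕ P ≅ N ⊕ Q` for some `F`-projective modules `P` and `Q`
      ∃ P Q : FGModuleCat A, RelHom.FProjective F P ∧ RelHom.FProjective F Q ∧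
        Nonempty (RelHom.dsum M P ≅ RelHom.dsum N Q),
      -- `M` and `N` are isomorphic in the `F`-stable category
      Nonempty (RelHom.toFStable F M ≅ RelHom.toFStable F N),
      -- `[M] = [N]` in `K_F(A)`
      RelHom.classKF F M = RelHom.classKF F N] := by
  have : IsArtinianRing A := IsArtinianRing.of_finite R A
  exact proposition4p4_general F hF M N
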